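/- Let $(\Omega,\mathcal F,P)$ be a probability space, let $X,X_1,X_2,\dots$ be i.i.d. real random variables and let $N$ be a random variable with values in $\{1,2,3,\dots\}$, independent of the sequence $(X_i)$. Put $S_N=\sum_{k=1}^N X_k$. For a random variable $Y$ let $R_Y(x)=-\log P(Y>x)$ be its hazard function; $Y$ is heavy-tailed if $E(e^{sY})=\infty$ for all $s>0$; a natural scale of $Y$ is a concave function $h\colon[0,\infty)\to[0,\infty)$ with $h(0)=0$, $h(x)\to\infty$ as $x\to\infty$ and $\liminf_{x\to\infty}R_Y(x)/h(x)=1$. If $h_N$ is a natural scale of $N$ and $c>0$, then $x\mapsto h_N(x/c)$ is a natural scale of $cN$; write $h_{cN}(x)=h_N(x/c)$. Suppose that $X$ and $N$ are heavy-tailed, $X\ge 0$ almost surely and $0<E(X)<\infty$. (1) Suppose $E((X^+)^{1+\delta})<\infty$ for some $\delta>0$, and let $h_X$ be a natural scale of $X$ such that $h_X(x)\ge(1+\delta)\log x$ for all large enough $x$ and $\lim_{x\to\infty}R_X(x)/h_X(x)=1$. If for some natural scale $h_N$ of $N$ and some $c_1>E(X)$ $$\liminf_{x\to\infty}\frac{h_{c_1N}(x)}{h_X(x)}=\liminf_{x\to\infty}\frac{h_N(x/c_1)}{h_X(x)}\in[1,\infty],$$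 then $R_{S_N}(x)\sim h_X(x)$ as $x\to\infty$. (2) Suppose $E(N^{1+\delta})<\infty$ for some $\delta>0$, and let $h_N$ be a natural scale of $N$ such that $h_N(x)\ge(1+\delta)\log x$ for all large enough $x$ and $\lim_{x\to\infty}R_{E(X)N}(x)/h_{E(X)N}(x)=1$, where $h_{E(X)N}(x)=h_N(x/E(X))$. If for some natural scale $h_X$ of $X$ $$\liminf_{x\to\infty}\frac{h_X(x)}{h_{E(X)N}(x)}=\liminf_{x\to\infty}\frac{h_X(x)}{h_N(x/E(X))}\in[1,\infty],$$ then $R_{S_N}(x)\sim h_{E(X)N}(x)$ as $x\to\infty$. -/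

import Mathlib

open MeasureTheory ProbabilityTheory Filter Topology

noncomputable section

/-- The random variable `X` is (right) heavy-tailed: `E (exp (s X)) = ∞` for all `s > 0`. -/
def HeavyTailed {Ω : Type*} [MeasurableSpace Ω] (μ : Measure Ω) (X : Ω → ℝ) : Prop :=
  ∀ s : ℝ, 0 < s → ∫⁻ ω, ENNReal.ofReal (Real.exp (s * X ω)) ∂μ = ⊤

/-- The hazard function `R_X(x) = - log P(X > x)`, an extended real number
(equal to `+∞` where `P(X > x) = 0`). -/
def hazard {Ω : Type*} [MeasurableSpace Ω] (μ : Measure Ω) (X : Ω → ℝ) (x : ℝ) : EReal :=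
  - ENNReal.log (μ {ω | x < X ω})

/-- `h` (only its values on `[0, ∞)` matter) is a natural scale of `X`: it is a concave function
`[0, ∞) → [0, ∞)` with `h 0 = 0`, `h x → ∞` and `liminf R_X(x) / h(x) = 1` as `x → ∞`. -/
structure IsNaturalScale {Ω : Type*} [MeasurableSpace Ω] (μ : Measure Ω) (X : Ω → ℝ)
    (h : ℝ → ℝ) : Prop where
  concaveOn : ConcaveOn ℝ (Set.Ici 0) h
  nonneg : ∀ x, 0 ≤ x → 0 ≤ h x
  map_zero : h 0 = 0
  tendsto_atTop : Tendsto h atTop atTop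
  liminf_eq_one : liminf (fun x : ℝ => hazard μ X x / (h x : EReal)) atTop = 1

/-- The randomly stopped sum `S_N = X_1 + ... + X_N`; the increments are numbered from `0`. -/
def stoppedSum {Ω : Type*} (X : ℕ → Ω → ℝ) (N : Ω → ℕ) (ω : Ω) : ℝ :=
  ∑ i ∈ Finset.range (N ω), X i ω

end

/-! Write m for the mean of X and h for the scale claimed for S_N. For the upper tail, both parts
reduce to one situation: for each ρ < 1, X and cN, for some c > m that may depend on ρ, have tails
at most e^{-ρh}. Shrinking h to g = ah with a < 1 makes E e^{g(X)} and E e^{g(cN)} finite;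
heavy-tailedness makes g sublinear.

The core is `IsScale.exists_measure_sum_gt_le`: for large x and all k at once, P(S_k > x) ≤ C
e^{-(1-2ε)g(x)} (k + e^{g(ck)}). Terms are cut at u = x/g(x) and at x. If all stay below u, the
exponential Markov inequality at rate g(x)/x sees only their mean, and concavity turns the resulting
e^{ck g(x)/x} into e^{g(ck)}. A term above x costs about k e^{-g(x)}. Intermediate terms are tested
at the slope of the chord of g over [u, x]; growth of g beyond (1+δ) log makes their effect on the
moment generating function o(1/u). Averaging over N gives
`IsScale.eventually_measure_stoppedSum_le`.

The matching lower bound comes from a single term in part (1), and in part (2) from the weak law: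
given a large N, S_N exceeds θmN, θ < 1, with probability at least 1/2. -/

/-- A scale function: concave and nonnegative on `[0, ∞)`, zero at `0`, tending to infinity. -/
structure IsScale (h : ℝ → ℝ) : Prop where
  concaveOn : ConcaveOn ℝ (Set.Ici 0) h
  nonneg : ∀ x, 0 ≤ x → 0 ≤ h x
  map_zero : h 0 = 0
  tendsto_atTop : Tendsto h atTop atTop

theorem IsNaturalScale.isScale {Ω : Type*} [MeasurableSpace Ω] {μ : Measure Ω} {X : Ω → ℝ}
    {h : ℝ → ℝ} (hh : IsNaturalScale μ X h) : IsScale h :=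
  ⟨hh.concaveOn, hh.nonneg, hh.map_zero, hh.tendsto_atTop⟩

/-! ### Elementary inequalities for concave scales -/

namespace IsScale

variable {h : ℝ → ℝ}

/-- A concave function that decreased once could not return to its earlier height, yet h is
unbounded: compare with a far point z where h z ≥ h x. -/
theorem monotoneOn (hh : IsScale h) : MonotoneOn h (Set.Ici 0) := by
  intro x hx y hy hxy
  obtain ⟨z, hz1, hz2⟩ := ((hh.tendsto_atTop.eventually_ge_atTop (h x)).and
    (eventually_ge_atTop y)).exists
  have hxz : x ≤ z := hxy.trans hz2
  have := hh.concaveOn.min_le_of_mem_Icc hx (show z ∈ Set.Ici (0 : ℝ) from le_trans hx hxz)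
    (show y ∈ Set.Icc x z from ⟨hxy, hz2⟩)
  rwa [min_eq_left hz1] at this

theorem le_of_le (hh : IsScale h) {x y : ℝ} (hx : 0 ≤ x) (hxy : x ≤ y) : h x ≤ h y :=
  hh.monotoneOn hx (hx.trans hxy) hxy

theorem mul_le (hh : IsScale h) {t x : ℝ} (ht0 : 0 ≤ t) (ht1 : t ≤ 1) (hx : 0 ≤ x) :
    t * h x ≤ h (t * x) := by
  have := hh.concaveOn.2 (show x ∈ Set.Ici (0 : ℝ) from hx)
    (show (0 : ℝ) ∈ Set.Ici (0 : ℝ) from Set.self_mem_Ici) ht0 (sub_nonneg.2 ht1) (by ring)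
  simpa [hh.map_zero] using this

theorem div_mul_le (hh : IsScale h) {x y : ℝ} (hx : 0 < x) (hy : 0 ≤ y) (hyx : y ≤ x) :
    h x / x * y ≤ h y := by
  have := hh.mul_le (t := y / x) (x := x) (by positivity) ((div_le_one hx).2 hyx) hx.le
  rw [div_mul_cancel₀ _ hx.ne'] at this
  calc h x / x * y = y / x * h x := by ring
    _ ≤ _ := this

theorem add_one_le (hh : IsScale h) {y : ℝ} (hy : 0 ≤ y) : h (y + 1) ≤ h y + h 1 := by
  have hp : 0 < y + 1 := by linarith
  have h1 := hh.div_mul_le hp hy (by linarith)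
  have h2 := hh.div_mul_le hp zero_le_one (by linarith)
  calc h (y + 1) = h (y + 1) / (y + 1) * y + h (y + 1) / (y + 1) * 1 := by field_simp
    _ ≤ _ := add_le_add h1 h2

/-- Concavity puts the graph above its chord. This trades a linear exponent on [u, x] for an
increment of h. -/
theorem slope_mul_le (hh : IsScale h) {u x y : ℝ} (hu : 0 ≤ u) (huy : u ≤ y) (hyx : y ≤ x)
    (hux : u < x) : (h x - h u) / (x - u) * (y - u) ≤ h y - h u := by
  have hd : 0 < x - u := sub_pos.2 hux
  have h1 : 0 ≤ (y - u) / (x - u) := div_nonneg (by linarith) hd.le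
  have h2 : (y - u) / (x - u) ≤ 1 := (div_le_one hd).2 (by linarith)
  have := hh.concaveOn.2 (show x ∈ Set.Ici (0 : ℝ) from hu.trans hux.le)
    (show u ∈ Set.Ici (0 : ℝ) from hu) h1 (sub_nonneg.2 h2) (by ring)
  simp only [smul_eq_mul] at this
  have e : (y - u) / (x - u) * x + (1 - (y - u) / (x - u)) * u = y := by
    field_simp; ring
  rw [e] at this
  calc (h x - h u) / (x - u) * (y - u) = (y - u) / (x - u) * (h x - h u) := by ring
    _ ≤ _ := by linarith

theorem slope_nonneg (hh : IsScale h) {u x : ℝ} (hu : 0 ≤ u) (hux : u < x) :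
    0 ≤ (h x - h u) / (x - u) :=
  div_nonneg (sub_nonneg.2 (hh.le_of_le hu hux.le)) (sub_nonneg.2 hux.le)

theorem slope_le_div (hh : IsScale h) {u x : ℝ} (hu : 0 ≤ u) (hux : u < x) :
    (h x - h u) / (x - u) ≤ h x / x := by
  have hx : 0 < x := hu.trans_lt hux
  have := hh.div_mul_le hx hu hux.le
  rw [div_le_iff₀ (sub_pos.2 hux)]
  have e : h x / x * (x - u) = h x - h x / x * u := by field_simp
  linarith

theorem const_mul (hh : IsScale h) {a : ℝ} (ha : 0 < a) : IsScale fun x => a * h x where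
  concaveOn := by simpa using hh.concaveOn.smul ha.le
  nonneg x hx := mul_nonneg ha.le (hh.nonneg x hx)
  map_zero := by simp [hh.map_zero]
  tendsto_atTop := hh.tendsto_atTop.const_mul_atTop ha

theorem comp_div (hh : IsScale h) {c : ℝ} (hc : 0 < c) : IsScale fun x => h (x / c) where
  concaveOn := by
    refine ⟨convex_Ici 0, fun x hx y hy a b ha hb hab => ?_⟩
    have := hh.concaveOn.2 (show x / c ∈ Set.Ici (0 : ℝ) from div_nonneg hx hc.le)
      (show y / c ∈ Set.Ici (0 : ℝ) from div_nonneg hy hc.le) ha hb hab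
    convert this using 2
    simp only [smul_eq_mul]; ring
  nonneg x hx := hh.nonneg _ (div_nonneg hx hc.le)
  map_zero := by simp [hh.map_zero]
  tendsto_atTop := hh.tendsto_atTop.comp (tendsto_id.atTop_div_const hc)

/-- A scale function extended by zero to the negative reals is measurable. -/
theorem measurable_comp_max (hh : IsScale h) : Measurable fun x => h (max 0 x) :=
  Monotone.measurable fun _ _ hxy => hh.le_of_le (le_max_left _ _) (max_le_max le_rfl hxy)

/-- The ratio h x / x is nonincreasing on (0, ∞), so it either keeps a positive lower bound or falls
below every ε for good. -/
theorem tendsto_div_or (hh : IsScale h) :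
    Tendsto (fun x => h x / x) atTop (𝓝 0) ∨ ∃ a > 0, ∀ x, 0 ≤ x → a * x ≤ h x := by
  by_cases H : ∃ a > 0, ∀ x, 0 ≤ x → a * x ≤ h x
  · exact Or.inr H
  left
  push Not at H
  rw [Metric.tendsto_atTop]
  intro ε hε
  obtain ⟨y, hy0, hy⟩ := H ε hε
  have hyp : 0 < y := by
    rcases hy0.eq_or_lt with rfl | h'
    · simp [hh.map_zero] at hy
    · exact h'
  refine ⟨y, fun x hx => ?_⟩
  have hxp : 0 < x := hyp.trans_le hx
  have h0 : 0 ≤ h x / x := div_nonneg (hh.nonneg x hxp.le) hxp.le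
  rw [Real.dist_0_eq_abs, abs_of_nonneg h0]
  have := hh.div_mul_le hxp hy0 hx
  exact lt_of_mul_lt_mul_right (this.trans_lt hy) hy0

end IsScale

/-! ### Exponentials in the extended nonnegative reals -/

/-- The real exponential with values in the extended nonnegative reals. -/
noncomputable def expE (t : ℝ) : ENNReal := ENNReal.ofReal (Real.exp t)

theorem expE_zero : expE 0 = 1 := by simp [expE]

theorem expE_add (s t : ℝ) : expE (s + t) = expE s * expE t := by
  rw [expE, Real.exp_add, ENNReal.ofReal_mul (Real.exp_pos _).le]; rfl

theorem expE_le_expE {s t : ℝ} (h : s ≤ t) : expE s ≤ expE t :=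
  ENNReal.ofReal_le_ofReal (Real.exp_le_exp.2 h)

theorem expE_ne_top (t : ℝ) : expE t ≠ ⊤ := ENNReal.ofReal_ne_top

theorem one_le_expE {t : ℝ} (h : 0 ≤ t) : 1 ≤ expE t := expE_zero ▸ expE_le_expE h

theorem expE_nat_mul (n : ℕ) (t : ℝ) : expE (n * t) = expE t ^ n := by
  rw [expE, Real.exp_nat_mul, ENNReal.ofReal_pow (Real.exp_pos _).le]; rfl

theorem expE_sum {ι : Type*} (s : Finset ι) (f : ι → ℝ) :
    expE (∑ i ∈ s, f i) = ∏ i ∈ s, expE (f i) := by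
  rw [expE, Real.exp_sum, ENNReal.ofReal_prod_of_nonneg fun _ _ => (Real.exp_pos _).le]; rfl

theorem measurable_expE : Measurable expE :=
  ENNReal.measurable_ofReal.comp Real.measurable_exp

theorem ofReal_le_expE (t : ℝ) : ENNReal.ofReal t ≤ expE t :=
  ENNReal.ofReal_le_ofReal ((le_add_of_nonneg_right zero_le_one).trans (Real.add_one_le_exp t))

theorem one_add_ofReal_le_expE {t : ℝ} (ht : 0 ≤ t) : 1 + ENNReal.ofReal t ≤ expE t := by
  rw [← ENNReal.ofReal_one, ← ENNReal.ofReal_add zero_le_one ht]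
  exact ENNReal.ofReal_le_ofReal (by linarith [Real.add_one_le_exp t])

theorem log_expE (t : ℝ) : ENNReal.log (expE t) = t := by
  rw [expE, ENNReal.log_ofReal_of_pos (Real.exp_pos _), Real.log_exp]

/-! ### Hazard ratios as tail inequalities -/

section Hazard

variable {Ω : Type*} [MeasurableSpace Ω] {μ : Measure Ω} {Y : Ω → ℝ} {h : ℝ → ℝ}

theorem le_hazard_div_iff {x H ρ : ℝ} (hH : 0 < H) :
    (ρ : EReal) ≤ hazard μ Y x / (H : EReal) ↔ μ {ω | x < Y ω} ≤ expE (-(ρ * H)) := by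
  rw [EReal.le_div_iff_mul_le (by exact_mod_cast hH) (EReal.coe_ne_top _), hazard, EReal.le_neg,
    ← ENNReal.log_le_log_iff, log_expE, EReal.coe_neg, EReal.coe_mul]

theorem hazard_div_le_iff {x H ρ : ℝ} (hH : 0 < H) :
    hazard μ Y x / (H : EReal) ≤ (ρ : EReal) ↔ expE (-(ρ * H)) ≤ μ {ω | x < Y ω} := by
  rw [EReal.div_le_iff_le_mul (by exact_mod_cast hH) (EReal.coe_ne_top _), hazard, EReal.neg_le,
    ← ENNReal.log_le_log_iff, log_expE, EReal.coe_neg, EReal.coe_mul, mul_comm]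

theorem eventually_measure_le_of_liminf (hh : Tendsto h atTop atTop)
    (hl : 1 ≤ liminf (fun x : ℝ => hazard μ Y x / (h x : EReal)) atTop) {ρ : ℝ} (hρ : ρ < 1) :
    ∀ᶠ x in atTop, μ {ω | x < Y ω} ≤ expE (-(ρ * h x)) := by
  have h1 : (ρ : EReal) < liminf (fun x : ℝ => hazard μ Y x / (h x : EReal)) atTop :=
    lt_of_lt_of_le (by exact_mod_cast hρ) hl
  filter_upwards [eventually_lt_of_lt_liminf h1, hh.eventually_gt_atTop 0] with x hx hx0
  exact (le_hazard_div_iff hx0).1 hx.le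

theorem eventually_le_measure_of_tendsto (hh : Tendsto h atTop atTop)
    (hl : Tendsto (fun x : ℝ => hazard μ Y x / (h x : EReal)) atTop (𝓝 1)) {ρ : ℝ} (hρ : 1 < ρ) :
    ∀ᶠ x in atTop, expE (-(ρ * h x)) ≤ μ {ω | x < Y ω} := by
  have h1 : (1 : EReal) < (ρ : EReal) := by exact_mod_cast hρ
  filter_upwards [hl.eventually_lt_const h1, hh.eventually_gt_atTop 0] with x hx hx0
  exact (hazard_div_le_iff hx0).1 hx.le

/-- Removes extended reals from the goal: only exponential tail bounds with factors on either side
of 1 remain to be proved. -/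
theorem tendsto_hazard_div (hh : Tendsto h atTop atTop)
    (hu : ∀ ρ : ℝ, 0 < ρ → ρ < 1 → ∀ᶠ x in atTop, μ {ω | x < Y ω} ≤ expE (-(ρ * h x)))
    (hl : ∀ ρ : ℝ, 1 < ρ → ∀ᶠ x in atTop, expE (-(ρ * h x)) ≤ μ {ω | x < Y ω}) :
    Tendsto (fun x : ℝ => hazard μ Y x / (h x : EReal)) atTop (𝓝 1) := by
  rw [tendsto_order]
  constructor
  · intro a ha
    obtain ⟨r, har, hr⟩ := EReal.lt_iff_exists_real_btwn.1 ha
    have hr1 : r < 1 := by exact_mod_cast hr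
    have : a < ((max r (1 / 2) : ℝ) : EReal) :=
      har.trans_le (by exact_mod_cast le_max_left _ _)
    filter_upwards [hu (max r (1 / 2)) (lt_max_of_lt_right (by norm_num))
      (max_lt hr1 (by norm_num)), hh.eventually_gt_atTop 0] with x hx hx0
    exact this.trans_le ((le_hazard_div_iff hx0).2 hx)
  · intro a ha
    obtain ⟨r, hr, har⟩ := EReal.lt_iff_exists_real_btwn.1 ha
    have hr1 : 1 < r := by exact_mod_cast hr
    filter_upwards [hl r hr1, hh.eventually_gt_atTop 0] with x hx hx0
    exact ((hazard_div_le_iff hx0).2 hx).trans_lt har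

end Hazard

/-! ### From tails to exponential moments -/

section Moment

variable {Ω : Type*} [MeasurableSpace Ω] {μ : Measure Ω} [IsProbabilityMeasure μ]
  {Y : Ω → ℝ} {h : ℝ → ℝ}

theorem IsScale.exists_forall_measure_le (hh : IsScale h) {ρ : ℝ} (hρ : 0 ≤ ρ)
    (ht : ∀ᶠ x in atTop, μ {ω | x < Y ω} ≤ expE (-(ρ * h x))) :
    ∃ C : ℝ, 0 ≤ C ∧ ∀ x, 0 ≤ x → μ {ω | x < Y ω} ≤ expE (C - ρ * h x) := by
  obtain ⟨a, ha⟩ := eventually_atTop.1 ht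
  have hC : 0 ≤ ρ * h (max a 0) := mul_nonneg hρ (hh.nonneg _ (le_max_right _ _))
  refine ⟨ρ * h (max a 0), hC, fun x hx => ?_⟩
  by_cases hax : a ≤ x
  · exact (ha x hax).trans (expE_le_expE (by linarith))
  · refine prob_le_one.trans (one_le_expE ?_)
    have := mul_le_mul_of_nonneg_left
      (hh.le_of_le hx ((not_le.1 hax).le.trans (le_max_left a 0))) hρ
    linarith

/-- Levels of a scale function: `h` exceeds `n` only beyond a point where it is almost `n`. -/
theorem IsScale.exists_level (hh : IsScale h) {n : ℕ} (hn : 0 < n) :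
    ∃ y, 0 ≤ y ∧ (n : ℝ) - h 1 ≤ h y ∧ ∀ x, 0 ≤ x → (n : ℝ) ≤ h x → y < x := by
  classical
  -- Searching over integers avoids continuity, which a concave scale may lack at 0; the overshoot
  -- of one unit step is at most `h 1`.
  have hex : ∃ j : ℕ, (n : ℝ) ≤ h j :=
    ((hh.tendsto_atTop.comp tendsto_natCast_atTop_atTop).eventually_ge_atTop (n : ℝ)).exists
  obtain ⟨j, hj, hmin⟩ : ∃ j : ℕ, (n : ℝ) ≤ h j ∧ ∀ i < j, ¬ (n : ℝ) ≤ h i :=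
    ⟨Nat.find hex, Nat.find_spec hex, fun i hi => Nat.find_min hex hi⟩
  rcases j with _ | j
  · simp [hh.map_zero] at hj; omega
  · refine ⟨j, j.cast_nonneg, ?_, fun x hx hnx => ?_⟩
    · push_cast at hj
      have := hh.add_one_le (y := j) j.cast_nonneg
      linarith
    · by_contra hxj
      exact hmin j (Nat.lt_succ_self j) (hnx.trans (hh.le_of_le hx (not_lt.1 hxj)))

/-- Exponential moments along a scale function from a tail bound. -/
theorem IsScale.lintegral_expE_lt_top (hh : IsScale h) (hY : Measurable Y)
    {a b : ℝ} (hb : 0 < b) (hba : b < a)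
    (ht : ∀ᶠ x in atTop, μ {ω | x < Y ω} ≤ expE (-(a * h x))) :
    ∫⁻ ω, expE (b * h (max 0 (Y ω))) ∂μ < ⊤ := by
  obtain ⟨C, hC, htail⟩ := hh.exists_forall_measure_le (hb.trans hba).le ht
  have hh1 := hh.nonneg 1 zero_le_one
  have hlev : ∀ n : ℕ, ∃ A : Set Ω, MeasurableSet A ∧
      (∀ ω, (n : ℝ) ≤ h (max 0 (Y ω)) → ω ∈ A) ∧ μ A ≤ expE (C - a * (n - h 1)) := by
    intro n
    rcases Nat.eq_zero_or_pos n with rfl | hn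
    · exact ⟨Set.univ, .univ, fun _ _ => Set.mem_univ _, prob_le_one.trans (one_le_expE (by
        have := mul_nonneg (hb.trans hba).le hh1
        push_cast; linarith))⟩
    · obtain ⟨y, hy0, hy1, hy2⟩ := hh.exists_level hn
      refine ⟨{ω | y < Y ω}, measurableSet_lt measurable_const hY, fun ω hω => ?_, ?_⟩
      · have := hy2 _ (le_max_left _ _) hω
        exact (lt_max_iff.1 this).resolve_left (not_lt.2 hy0)
      · exact (htail y hy0).trans (expE_le_expE (by
          have := mul_le_mul_of_nonneg_left hy1 (hb.trans hba).le
          linarith))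
  choose A hAm hA hAle using hlev
  -- Slice by the integer part n of h(Y): slice n weighs at most a constant times e^{(b-a)n}, a
  -- convergent geometric series.
  have hpt : ∀ ω, expE (b * h (max 0 (Y ω))) ≤
      ∑' n : ℕ, (A n).indicator (fun _ => expE (b * (n + 1))) ω := by
    intro ω
    have hn0 := hh.nonneg _ (le_max_left 0 (Y ω))
    refine le_trans ?_ (ENNReal.le_tsum ⌊h (max 0 (Y ω))⌋₊)
    rw [Set.indicator_of_mem (hA _ ω (Nat.floor_le hn0))]
    exact expE_le_expE (mul_le_mul_of_nonneg_left (Nat.lt_floor_add_one _).le hb.le)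
  have hr : expE (b - a) < 1 := by
    rw [← ENNReal.ofReal_one]
    exact (ENNReal.ofReal_lt_ofReal_iff one_pos).2 (by simpa using hba)
  calc ∫⁻ ω, expE (b * h (max 0 (Y ω))) ∂μ
      ≤ ∫⁻ ω, ∑' n : ℕ, (A n).indicator (fun _ => expE (b * (n + 1))) ω ∂μ := lintegral_mono hpt
    _ = ∑' n : ℕ, expE (b * (n + 1)) * μ (A n) := by
        rw [lintegral_tsum fun n => (measurable_const.indicator (hAm n)).aemeasurable]
        exact tsum_congr fun n => lintegral_indicator_const (hAm n) _
    _ ≤ ∑' n : ℕ, expE (b + C + a * h 1) * expE (b - a) ^ n := by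
        refine ENNReal.tsum_le_tsum fun n => ?_
        refine (mul_le_mul_right (hAle n) _).trans ?_
        rw [← expE_nat_mul, ← expE_add, ← expE_add]
        exact expE_le_expE (by linarith)
    _ < ⊤ := by
        rw [ENNReal.tsum_mul_left, ENNReal.tsum_geometric]
        refine ENNReal.mul_lt_top (expE_ne_top _).lt_top ?_
        rw [ENNReal.inv_lt_top]
        exact tsub_pos_of_lt hr

/-- A scale function that bounds a heavy tail is sublinear. -/
theorem HeavyTailed.tendsto_div (hY : HeavyTailed μ Y) (hm : Measurable Y) (hh : IsScale h)
    {a : ℝ} (ha : 0 < a) (ht : ∀ᶠ x in atTop, μ {ω | x < Y ω} ≤ expE (-(a * h x))) :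
    Tendsto (fun x => h x / x) atTop (𝓝 0) := by
  refine hh.tendsto_div_or.resolve_right ?_
  rintro ⟨r, hr, hle⟩
  have hfin := hh.lintegral_expE_lt_top hm (half_pos ha) (half_lt_self ha) ht
  refine (lt_of_le_of_lt (lintegral_mono fun ω => ?_) hfin).ne (hY (a / 2 * r) (by positivity))
  refine expE_le_expE ?_
  rw [mul_assoc]
  exact mul_le_mul_of_nonneg_left ((mul_le_mul_of_nonneg_left (le_max_right 0 (Y ω)) hr.le).trans
    (hle _ (le_max_left _ _))) (half_pos ha).le

end Moment

/-! ### Exponential Markov bounds, truncated moments and conditioning on N -/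

section Sums

variable {Ω : Type*} [MeasurableSpace Ω] {μ : Measure Ω}
  {X : ℕ → Ω → ℝ}

/-- The functions may depend on the index, so that one distinguished term can be confined to a
different set from the others. -/
theorem lintegral_prod_comp_iid (hXmeas : ∀ i, Measurable (X i)) (hXindep : iIndepFun X μ)
    (hXident : ∀ i, IdentDistrib (X i) (X 0) μ μ) (s : Finset ℕ) {φ : ℕ → ℝ → ENNReal}
    (hφ : ∀ i, Measurable (φ i)) :
    ∫⁻ ω, ∏ i ∈ s, φ i (X i ω) ∂μ = ∏ i ∈ s, ∫⁻ ω, φ i (X 0 ω) ∂μ := by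
  have h := lintegral_prod_eq_prod_lintegral_of_indepFun s (fun i => φ i ∘ X i)
    (hXindep.comp φ hφ) (fun i => (hφ i).comp (hXmeas i))
  simp only [Function.comp_apply] at h
  rw [h]
  exact Finset.prod_congr rfl fun i _ => ((hXident i).comp (hφ i)).lintegral_eq

/-- The exponential Markov inequality for a sum whose terms are confined to given sets. -/
theorem measure_sum_gt_and_mem_le (hXmeas : ∀ i, Measurable (X i)) (hXindep : iIndepFun X μ)
    (hXident : ∀ i, IdentDistrib (X i) (X 0) μ μ) {A : ℕ → Set ℝ} (hA : ∀ i, MeasurableSet (A i))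
    {s : ℝ} (hs : 0 ≤ s) (k : ℕ) (x : ℝ) :
    μ {ω | x < ∑ i ∈ Finset.range k, X i ω ∧ ∀ i ∈ Finset.range k, X i ω ∈ A i} ≤
      expE (-(s * x)) * ∏ i ∈ Finset.range k,
        ∫⁻ ω, (A i).indicator (fun y => expE (s * y)) (X 0 ω) ∂μ := by
  have hφ : ∀ i, Measurable ((A i).indicator fun y => expE (s * y)) := fun i =>
    (measurable_expE.comp (measurable_id.const_mul s)).indicator (hA i)
  have hm : Measurable fun ω => ∏ i ∈ Finset.range k,
      (A i).indicator (fun y => expE (s * y)) (X i ω) :=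
    Finset.measurable_fun_prod _ fun i _ => (hφ i).comp (hXmeas i)
  rw [← lintegral_prod_comp_iid hXmeas hXindep hXident _ hφ, ← lintegral_const_mul _ hm]
  refine meas_le_lintegral₀ (hm.const_mul _).aemeasurable ?_
  rintro ω ⟨h1, h2⟩
  rw [Finset.prod_congr rfl fun i hi => Set.indicator_of_mem (h2 i hi) _, ← expE_sum, ← expE_add,
    ← Finset.mul_sum]
  exact one_le_expE (by nlinarith)

/-- Dominated convergence: for 0 ≤ y ≤ u the integrand differs from y by at most y²/u, which tends
to 0 and is itself at most y. -/
theorem tendsto_integral_truncated_exp [IsProbabilityMeasure μ] {Y : Ω → ℝ} (hY : Measurable Y) (hint : Integrable Y μ)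
    (hY0 : ∀ᵐ ω ∂μ, 0 ≤ Y ω) :
    Tendsto (fun u : ℝ => ∫ ω, (Set.Iic u).indicator (fun y => u * (Real.exp (y / u) - 1)) (Y ω) ∂μ)
      atTop (𝓝 (∫ ω, Y ω ∂μ)) := by
  have key : ∀ y u : ℝ, 0 ≤ y → 0 < u → y ≤ u →
      |u * (Real.exp (y / u) - 1) - y| ≤ y * y / u := by
    intro y u hy hu hyu
    have h1 : |y / u| ≤ 1 := by
      rw [abs_of_nonneg (by positivity)]; exact (div_le_one hu).2 hyu
    have h2 := Real.abs_exp_sub_one_sub_id_le h1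
    have e : u * (Real.exp (y / u) - 1) - y = u * (Real.exp (y / u) - 1 - y / u) := by
      field_simp
    rw [e, abs_mul, abs_of_pos hu]
    calc u * |Real.exp (y / u) - 1 - y / u| ≤ u * (y / u) ^ 2 := by gcongr
      _ = y * y / u := by field_simp
  refine tendsto_integral_filter_of_dominated_convergence (fun ω => 2 * Y ω) ?_ ?_
    (hint.const_mul 2) ?_
  · refine Eventually.of_forall fun u => ?_
    have hm : Measurable ((Set.Iic u).indicator fun y => u * (Real.exp (y / u) - 1)) :=
      Measurable.indicator (by fun_prop) measurableSet_Iic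
    exact (hm.comp hY).aestronglyMeasurable
  · filter_upwards [eventually_gt_atTop 0] with u hu
    filter_upwards [hY0] with ω hω
    by_cases h : Y ω ≤ u
    · rw [Set.indicator_of_mem (show Y ω ∈ Set.Iic u from h), Real.norm_eq_abs]
      have h1 := key _ _ hω hu h
      have h2 : Y ω * Y ω / u ≤ Y ω := by
        rw [div_le_iff₀ hu]; gcongr
      rw [abs_le] at h1 ⊢
      constructor <;> linarith
    · rw [Set.indicator_of_notMem (show Y ω ∉ Set.Iic u from h), norm_zero]
      linarith
  · filter_upwards [hY0] with ω hω
    have h0 : Tendsto (fun u : ℝ => Y ω * Y ω / u) atTop (𝓝 0) :=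
      tendsto_const_nhds.div_atTop tendsto_id
    rw [tendsto_iff_norm_sub_tendsto_zero]
    refine squeeze_zero' (Eventually.of_forall fun _ => norm_nonneg _) ?_ h0
    filter_upwards [eventually_gt_atTop 0, eventually_ge_atTop (Y ω)] with u hu h
    rw [Set.indicator_of_mem (show Y ω ∈ Set.Iic u from h), Real.norm_eq_abs]
    exact key _ _ hω hu h

/-- The truncated moment generating function at arguments up to the inverse truncation level. -/
theorem eventually_lintegral_truncated_expE_le [IsProbabilityMeasure μ] {Y : Ω → ℝ} (hY : Measurable Y)
    (hint : Integrable Y μ) (hY0 : ∀ᵐ ω ∂μ, 0 ≤ Y ω) {c : ℝ} (hc : ∫ ω, Y ω ∂μ < c) :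
    ∀ᶠ u in atTop, ∀ s : ℝ, 0 ≤ s → s * u ≤ 1 →
      ∫⁻ ω, (Set.Iic u).indicator (fun y => expE (s * y)) (Y ω) ∂μ ≤ expE (s * c) := by
  filter_upwards [(tendsto_integral_truncated_exp hY hint hY0).eventually_lt_const hc,
    eventually_gt_atTop 0] with u hu hu0 s hs hsu
  set G : ℝ → ℝ := (Set.Iic u).indicator (fun y => u * (Real.exp (y / u) - 1)) with hG
  have hGm : Measurable fun ω => G (Y ω) := by
    have hm : Measurable G := Measurable.indicator (by fun_prop) measurableSet_Iic
    exact hm.comp hY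
  have hG0 : ∀ y, 0 ≤ y → 0 ≤ G y := by
    intro y hy
    refine Set.indicator_apply_nonneg fun _ => ?_
    exact mul_nonneg hu0.le (sub_nonneg.2 (Real.one_le_exp (by positivity)))
  have hGle : ∀ y, 0 ≤ y → G y ≤ u * (Real.exp 1 - 1) := by
    intro y hy
    by_cases h : y ≤ u
    · rw [hG, Set.indicator_of_mem (show y ∈ Set.Iic u from h)]
      have : y / u ≤ 1 := (div_le_one hu0).2 h
      gcongr
    · rw [hG, Set.indicator_of_notMem (show y ∉ Set.Iic u from h)]
      exact mul_nonneg hu0.le (sub_nonneg.2 (Real.one_le_exp zero_le_one))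
  have hGint : Integrable (fun ω => G (Y ω)) μ := by
    refine Integrable.of_bound hGm.aestronglyMeasurable (u * (Real.exp 1 - 1)) ?_
    filter_upwards [hY0] with ω hω
    rw [Real.norm_eq_abs, abs_of_nonneg (hG0 _ hω)]
    exact hGle _ hω
  have hc0 : 0 ≤ c := (integral_nonneg_of_ae hY0).trans hc.le
  calc ∫⁻ ω, (Set.Iic u).indicator (fun y => expE (s * y)) (Y ω) ∂μ
      ≤ ∫⁻ ω, (1 + ENNReal.ofReal (s * G (Y ω))) ∂μ := by
        refine lintegral_mono_ae ?_
        filter_upwards [hY0] with ω hω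
        by_cases h : Y ω ≤ u
        · rw [hG, Set.indicator_of_mem (show Y ω ∈ Set.Iic u from h),
            Set.indicator_of_mem (show Y ω ∈ Set.Iic u from h), ← ENNReal.ofReal_one,
            ← ENNReal.ofReal_add zero_le_one (mul_nonneg hs (mul_nonneg hu0.le
              (sub_nonneg.2 (Real.one_le_exp (by positivity)))))]
          refine ENNReal.ofReal_le_ofReal ?_
          -- With t = su in [0, 1], convexity gives e^{ty/u} - 1 ≤ t(e^{y/u} - 1), so the single
          -- rate 1/u controls all smaller rates.
          have := convexOn_exp.2 (Set.mem_univ (Y ω / u)) (Set.mem_univ 0)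
            (mul_nonneg hs hu0.le) (sub_nonneg.2 hsu) (by ring)
          simp only [smul_eq_mul, mul_zero, add_zero, Real.exp_zero, mul_one] at this
          rw [show s * u * (Y ω / u) = s * Y ω by field_simp] at this
          linarith
        · rw [Set.indicator_of_notMem (show Y ω ∉ Set.Iic u from h)]
          exact zero_le
    _ = 1 + ENNReal.ofReal (s * ∫ ω, G (Y ω) ∂μ) := by
        rw [lintegral_add_left measurable_const, lintegral_const, measure_univ, mul_one,
          ← integral_const_mul, ofReal_integral_eq_lintegral_ofReal (hGint.const_mul s)]
        filter_upwards [hY0] with ω hω using mul_nonneg hs (hG0 _ hω)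
    _ ≤ 1 + ENNReal.ofReal (s * c) := by gcongr
    _ ≤ expE (s * c) := one_add_ofReal_le_expE (mul_nonneg hs hc0)

/-- The tail of the stopped sum, conditioned on the independent number of terms. -/
theorem measure_lt_stoppedSum {N : Ω → ℕ} (hXmeas : ∀ i, Measurable (X i)) (hNmeas : Measurable N)
    (hNindep : IndepFun N (fun ω i => X i ω) μ) (x : ℝ) :
    μ {ω | x < stoppedSum X N ω} =
      ∫⁻ ω, μ {ω' | x < ∑ i ∈ Finset.range (N ω), X i ω'} ∂μ := by
  have hmap : ∫⁻ ω, μ {ω' | x < ∑ i ∈ Finset.range (N ω), X i ω'} ∂μ =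
      ∑' k : ℕ, μ {ω' | x < ∑ i ∈ Finset.range k, X i ω'} * μ (N ⁻¹' {k}) := by
    rw [← lintegral_map (f := fun k : ℕ => μ {ω' | x < ∑ i ∈ Finset.range k, X i ω'})
      measurable_from_top hNmeas, lintegral_countable']
    exact tsum_congr fun k => by rw [Measure.map_apply hNmeas (measurableSet_singleton k)]
  have hE : ∀ k, MeasurableSet {z : ℕ → ℝ | x < ∑ i ∈ Finset.range k, z i} := fun k =>
    measurableSet_lt measurable_const
      (Finset.measurable_fun_sum _ fun i _ => measurable_pi_apply i)
  have hS : {ω | x < stoppedSum X N ω} =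
      ⋃ k : ℕ, N ⁻¹' {k} ∩ (fun ω i => X i ω) ⁻¹' {z | x < ∑ i ∈ Finset.range k, z i} := by
    ext ω
    simp [stoppedSum]
  have hXm : Measurable fun ω i => X i ω := measurable_pi_lambda _ hXmeas
  rw [hmap, hS, measure_iUnion]
  · refine tsum_congr fun k => ?_
    rw [hNindep.measure_inter_preimage_eq_mul _ _ (measurableSet_singleton k) (hE k), mul_comm]
    rfl
  · intro i j hij
    refine Set.disjoint_left.2 ?_
    rintro ω ⟨h1, -⟩ ⟨h2, -⟩
    exact hij (h1.symm.trans h2)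
  · exact fun k => (hNmeas (measurableSet_singleton k)).inter (hXm (hE k))

end Sums

/-! ### Consequences of sublinearity and of logarithmic growth -/

namespace IsScale

variable {g : ℝ → ℝ}

theorem tendsto_div_self_atTop (hg : IsScale g) (hg0 : Tendsto (fun x => g x / x) atTop (𝓝 0)) :
    Tendsto (fun x => x / g x) atTop atTop := by
  have h : Tendsto (fun x => g x / x) atTop (𝓝[>] 0) := by
    refine tendsto_nhdsWithin_iff.2 ⟨hg0, ?_⟩
    filter_upwards [hg.tendsto_atTop.eventually_gt_atTop 0, eventually_gt_atTop 0] with x h1 h2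
    exact div_pos h1 h2
  refine h.inv_tendsto_nhdsGT_zero.congr fun x => ?_
  simp

/-- Evaluate the logarithmic bound at u = x/g(x); the correction (1+δ) log g(x) is negligible
against g(x). It serves to absorb a count k ≤ x/c. -/
theorem eventually_log_le (hg : IsScale g) (hg0 : Tendsto (fun x => g x / x) atTop (𝓝 0))
    {δ : ℝ} (hδ : 0 < δ) (hlog : ∀ᶠ x in atTop, (1 + δ) * Real.log x ≤ g x) {ε : ℝ} (hε : 0 < ε) :
    ∀ᶠ x in atTop, Real.log x ≤ g (x / g x) + ε * g x := by
  have h1 : ∀ᶠ y : ℝ in atTop, (1 + δ) * Real.log y ≤ ε * y := by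
    have := (Real.isLittleO_log_id_atTop.const_mul_left (1 + δ)).bound hε
    filter_upwards [this, eventually_ge_atTop 0] with y hy hy0
    simp only [id, Real.norm_eq_abs, abs_of_nonneg hy0] at hy
    exact (le_abs_self _).trans hy
  filter_upwards [(hg.tendsto_div_self_atTop hg0).eventually hlog, hg.tendsto_atTop.eventually h1,
    hg.tendsto_atTop.eventually_gt_atTop 0, eventually_ge_atTop 1] with x hx1 hx2 hx3 hx4
  rw [Real.log_div (by linarith) hx3.ne'] at hx1
  have := mul_nonneg hδ.le (Real.log_nonneg hx4)
  linarith

/-- Here the strict excess δ is essential: e^{-g(u)} ≤ u^{-1-δ} is o(1/u), small enough to survive a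
k-th power with k of order x. -/
theorem eventually_expE_mul_le {δ : ℝ} (hδ : 0 < δ)
    (hlog : ∀ᶠ x in atTop, (1 + δ) * Real.log x ≤ g x) {K : ENNReal} (hK : K ≠ ⊤) {ε : ℝ}
    (hε : 0 < ε) : ∀ᶠ u in atTop, expE (1 - g u) * K ≤ ENNReal.ofReal (ε / u) := by
  have h1 : Tendsto (fun u : ℝ => δ * Real.log u) atTop atTop :=
    Real.tendsto_log_atTop.const_mul_atTop hδ
  filter_upwards [hlog, h1.eventually_ge_atTop (1 + K.toReal - Real.log ε),
    eventually_gt_atTop 0] with u hu1 hu2 hu3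
  calc expE (1 - g u) * K = expE (1 - g u) * ENNReal.ofReal K.toReal := by
        rw [ENNReal.ofReal_toReal hK]
    _ ≤ expE (1 - g u) * expE K.toReal := by gcongr; exact ofReal_le_expE _
    _ = expE (1 - g u + K.toReal) := (expE_add _ _).symm
    _ ≤ expE (Real.log (ε / u)) := by
        refine expE_le_expE ?_
        rw [Real.log_div hε.ne' hu3.ne']
        linarith
    _ = ENNReal.ofReal (ε / u) := by rw [expE, Real.exp_log (by positivity)]

end IsScale

/-! ### Uniform tail bound for partial sums and its average over N -/

section Main

variable {Ω : Type*} [MeasurableSpace Ω] {μ : Measure Ω}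
  {X : ℕ → Ω → ℝ} {g : ℝ → ℝ}

theorem IsScale.measure_gt_le (hg : IsScale g) {Y : Ω → ℝ} (hY : Measurable Y) {x : ℝ}
    (hx : 0 ≤ x) :
    μ {ω | x < Y ω} ≤ expE (-g x) * ∫⁻ ω, expE (g (max 0 (Y ω))) ∂μ := by
  have hm : Measurable fun ω => expE (g (max 0 (Y ω))) :=
    measurable_expE.comp (hg.measurable_comp_max.comp hY)
  rw [← lintegral_const_mul _ hm]
  refine meas_le_lintegral₀ (hm.const_mul _).aemeasurable fun ω hω => ?_
  rw [← expE_add]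
  refine one_le_expE ?_
  have := hg.le_of_le hx ((le_of_lt hω).trans (le_max_right 0 (Y ω)))
  linarith

/-- Exponential moment over a window, at the slope of the scale function on that window. -/
theorem IsScale.lintegral_window_le (hg : IsScale g) {Y : Ω → ℝ} (hY : Measurable Y) {u x : ℝ}
    (hu : 0 ≤ u) (hux : u < x) :
    ∫⁻ ω, (Set.Ioc u x).indicator (fun y => expE ((g x - g u) / (x - u) * y)) (Y ω) ∂μ ≤
      expE ((g x - g u) / (x - u) * u - g u) * ∫⁻ ω, expE (g (max 0 (Y ω))) ∂μ := by
  have hm : Measurable fun ω => expE (g (max 0 (Y ω))) :=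
    measurable_expE.comp (hg.measurable_comp_max.comp hY)
  rw [← lintegral_const_mul _ hm]
  refine lintegral_mono fun ω => ?_
  refine Set.indicator_apply_le' (fun hω => ?_) fun _ => zero_le
  rw [← expE_add, max_eq_right (hu.trans hω.1.le)]
  have := hg.slope_mul_le hu hω.1.le hω.2 hux
  exact expE_le_expE (by linarith)

/-- Exponential Markov bound on the event that some term exceeds `u` and none exceeds `x`. -/
theorem measure_sum_gt_and_exists_gt_le (hXmeas : ∀ i, Measurable (X i)) (hXindep : iIndepFun X μ)
    (hXident : ∀ i, IdentDistrib (X i) (X 0) μ μ) {s : ℝ} (hs : 0 ≤ s) (u x : ℝ) (k : ℕ)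
    {J B : ENNReal}
    (hJ : ∫⁻ ω, (Set.Ioc u x).indicator (fun y => expE (s * y)) (X 0 ω) ∂μ ≤ J)
    (hB : ∫⁻ ω, (Set.Iic x).indicator (fun y => expE (s * y)) (X 0 ω) ∂μ ≤ B) (hB1 : 1 ≤ B) :
    μ {ω | x < ∑ i ∈ Finset.range k, X i ω ∧ (∀ i ∈ Finset.range k, X i ω ≤ x) ∧
      ∃ i ∈ Finset.range k, u < X i ω} ≤ k * (expE (-(s * x)) * (J * B ^ k)) := by
  classical
  -- Term i lies in the window and the others only below x; the union over i produces the factor k.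
  set A : ℕ → ℕ → Set ℝ := fun i j => if j = i then Set.Ioc u x else Set.Iic x with hA
  have hsub : {ω | x < ∑ i ∈ Finset.range k, X i ω ∧ (∀ i ∈ Finset.range k, X i ω ≤ x) ∧
      ∃ i ∈ Finset.range k, u < X i ω} ⊆ ⋃ i ∈ Finset.range k,
      {ω | x < ∑ i ∈ Finset.range k, X i ω ∧ ∀ j ∈ Finset.range k, X j ω ∈ A i j} := by
    rintro ω ⟨h1, h2, i, hi, h3⟩
    refine Set.mem_biUnion (x := i) hi ⟨h1, fun j hj => ?_⟩
    by_cases hji : j = i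
    · subst hji
      simp only [hA, if_true]
      exact ⟨h3, h2 j hj⟩
    · simp only [hA, if_neg hji]
      exact h2 j hj
  refine (measure_mono hsub).trans ((measure_biUnion_finset_le _ _).trans ?_)
  refine (Finset.sum_le_card_nsmul (Finset.range k) _ (expE (-(s * x)) * (J * B ^ k))
    fun i hi => ?_).trans_eq (by rw [Finset.card_range, nsmul_eq_mul])
  have hAm : ∀ j, MeasurableSet (A i j) := fun j => by
    by_cases hji : j = i
    · simp only [hA, if_pos hji]; exact measurableSet_Ioc
    · simp only [hA, if_neg hji]; exact measurableSet_Iic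
  refine (measure_sum_gt_and_mem_le hXmeas hXindep hXident hAm hs k x).trans ?_
  gcongr
  rw [← Finset.mul_prod_erase _ _ hi]
  have e1 : A i i = Set.Ioc u x := by simp [hA]
  rw [e1]
  refine mul_le_mul' hJ ?_
  calc _ ≤ ∏ j ∈ (Finset.range k).erase i, B := by
        refine Finset.prod_le_prod' fun j hj => ?_
        have : A i j = Set.Iic x := by simp [hA, Finset.ne_of_mem_erase hj]
        rw [this]
        exact hB
    _ = B ^ (k - 1) := by rw [Finset.prod_const, Finset.card_erase_of_mem hi, Finset.card_range]
    _ ≤ B ^ k := pow_le_pow_right₀ hB1 (Nat.sub_le _ _)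

/-- Uniform tail bound for the partial sums of a nonnegative i.i.d. sequence, in terms of a
sublinear scale function that dominates a multiple larger than one of the logarithm. -/
theorem IsScale.exists_measure_sum_gt_le [IsProbabilityMeasure μ] (hg : IsScale g)
    (hg0 : Tendsto (fun x => g x / x) atTop (𝓝 0)) {δ : ℝ} (hδ : 0 < δ)
    (hlog : ∀ᶠ x in atTop, (1 + δ) * Real.log x ≤ g x)
    (hXmeas : ∀ i, Measurable (X i)) (hXindep : iIndepFun X μ)
    (hXident : ∀ i, IdentDistrib (X i) (X 0) μ μ) (hXint : Integrable (X 0) μ)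
    (hXnonneg : ∀ᵐ ω ∂μ, 0 ≤ X 0 ω)
    (hK : ∫⁻ ω, expE (g (max 0 (X 0 ω))) ∂μ < ⊤) {c : ℝ} (hc : ∫ ω, X 0 ω ∂μ < c)
    {ε : ℝ} (hε : 0 < ε) :
    ∃ C : ENNReal, C ≠ ⊤ ∧ ∀ᶠ x in atTop, ∀ k : ℕ,
      μ {ω | x < ∑ i ∈ Finset.range k, X i ω} ≤
        C * expE (-g x + 2 * ε * g x) * (k + expE (g (c * k))) := by
  set K := ∫⁻ ω, expE (g (max 0 (X 0 ω))) ∂μ with hKdef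
  have hc0 : 0 < c := (integral_nonneg_of_ae hXnonneg).trans_lt hc
  -- The summands pay for: all terms below u, a term above x, and a term in the window.
  refine ⟨1 + K + K * (expE 1 * (1 + ENNReal.ofReal c⁻¹)), by
    simp [ENNReal.mul_eq_top, hK.ne, expE_ne_top], ?_⟩
  have hu := hg.tendsto_div_self_atTop hg0
  filter_upwards [hu.eventually (eventually_lintegral_truncated_expE_le (hXmeas 0) hXint
      hXnonneg hc), hu.eventually (eventually_expE_mul_le hδ hlog hK.ne (mul_pos hε hc0)),
    hg.eventually_log_le hg0 hδ hlog hε, hg.tendsto_atTop.eventually_gt_atTop 1,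
    eventually_gt_atTop 0] with x hmgf hJ hlogx hgx hx k
  have hgx0 : 0 < g x := zero_lt_one.trans hgx
  -- This level makes the Markov rate g(x)/x equal to 1/u, the largest rate allowed by the truncated
  -- moment bound.
  set u := x / g x with hudef
  have hu0 : 0 < u := div_pos hx hgx0
  have hux : u < x := div_lt_self hx hgx
  have hsu1 : g x / x * u = 1 := by rw [hudef]; field_simp
  -- Past this point the bound is trivial, since e^{g(ck)} already compensates e^{-g(x)}.
  by_cases hkx : x < c * k
  · refine prob_le_one.trans ?_
    have h1 : 1 ≤ expE (-g x + 2 * ε * g x) * (k + expE (g (c * k))) := by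
      refine le_trans ?_ (mul_le_mul' (expE_le_expE (show -g x ≤ _ by nlinarith)) le_add_self)
      rw [← expE_add]
      have := hg.le_of_le hx.le hkx.le
      exact one_le_expE (by linarith)
    rw [mul_assoc]
    refine h1.trans (le_mul_of_one_le_left' ?_)
    rw [add_assoc]
    exact le_self_add
  have hck : c * k ≤ x := not_lt.1 hkx
  have hck0 : 0 ≤ c * k := by positivity
  -- With the chord slope, sy ≤ su - g(u) + g(y) on the window, and the Markov factor e^{-sx} times
  -- e^{su-g(u)} is exactly e^{-g(x)}.
  set s := (g x - g u) / (x - u) with hsdef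
  have hs0 : 0 ≤ s := hg.slope_nonneg hu0.le hux
  have hsle : s ≤ g x / x := hg.slope_le_div hu0.le hux
  have hsu : s * u ≤ 1 := (mul_le_mul_of_nonneg_right hsle hu0.le).trans hsu1.le
  have hsx : s * x = s * u + g x - g u := by
    have : s * (x - u) = g x - g u := div_mul_cancel₀ _ (sub_pos.2 hux).ne'
    linarith
  have hX0 : μ {ω | x < X 0 ω} ≤ expE (-g x) * K := hg.measure_gt_le (hXmeas 0) hx.le
  -- some term exceeds `x`
  have hbig : μ {ω | ∃ i ∈ Finset.range k, x < X i ω} ≤ k * (expE (-g x) * K) := by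
    have : {ω | ∃ i ∈ Finset.range k, x < X i ω} = ⋃ i ∈ Finset.range k, {ω | x < X i ω} := by
      ext ω; simp
    rw [this]
    refine (measure_biUnion_finset_le _ _).trans ?_
    refine (Finset.sum_le_card_nsmul (Finset.range k) _ (expE (-g x) * K)
      fun i _ => ?_).trans_eq (by rw [Finset.card_range, nsmul_eq_mul])
    exact ((hXident i).measure_mem_eq measurableSet_Ioi).trans_le hX0
  -- all terms are at most `u`
  have hsmall : μ {ω | x < ∑ i ∈ Finset.range k, X i ω ∧
      ∀ i ∈ Finset.range k, X i ω ∈ Set.Iic u} ≤ expE (-g x) * expE (g (c * k)) := by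
    refine (measure_sum_gt_and_mem_le hXmeas hXindep hXident (A := fun _ => Set.Iic u)
      (fun _ => measurableSet_Iic) (div_nonneg hgx0.le hx.le) k x).trans ?_
    rw [Finset.prod_const, Finset.card_range, div_mul_cancel₀ _ hx.ne']
    gcongr
    refine (pow_le_pow_left' (hmgf _ (div_nonneg hgx0.le hx.le) hsu1.le) k).trans ?_
    rw [← expE_nat_mul]
    have := hg.div_mul_le hx hck0 hck
    exact expE_le_expE (by linarith)
  -- some term lies between `u` and `x`, none exceeds `x`
  have hJs : ∫⁻ ω, (Set.Ioc u x).indicator (fun y => expE (s * y)) (X 0 ω) ∂μ ≤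
      expE (s * u - g u) * K := hg.lintegral_window_le (hXmeas 0) hu0.le hux
  have hB : ∫⁻ ω, (Set.Iic x).indicator (fun y => expE (s * y)) (X 0 ω) ∂μ ≤
      expE (s * c + ε * c / u) := by
    have hmeas : Measurable fun ω => (Set.Iic u).indicator (fun y => expE (s * y)) (X 0 ω) :=
      ((measurable_expE.comp (measurable_id.const_mul s)).indicator measurableSet_Iic).comp
        (hXmeas 0)
    calc ∫⁻ ω, (Set.Iic x).indicator (fun y => expE (s * y)) (X 0 ω) ∂μ
        = ∫⁻ ω, ((Set.Iic u).indicator (fun y => expE (s * y)) (X 0 ω) +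
            (Set.Ioc u x).indicator (fun y => expE (s * y)) (X 0 ω)) ∂μ := by
          refine lintegral_congr fun ω => ?_
          rw [← Set.Iic_union_Ioc_eq_Iic hux.le,
            Set.indicator_union_of_disjoint (Set.Iic_disjoint_Ioc le_rfl)]
      _ ≤ expE (s * c) + ENNReal.ofReal (ε * c / u) := by
          rw [lintegral_add_left hmeas]
          refine add_le_add (hmgf s hs0 hsu) (hJs.trans (le_trans ?_ hJ))
          gcongr
          exact expE_le_expE (by linarith)
      _ ≤ expE (s * c) + expE (s * c) * ENNReal.ofReal (ε * c / u) := by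
          gcongr
          exact le_mul_of_one_le_left' (one_le_expE (mul_nonneg hs0 hc0.le))
      _ = expE (s * c) * (1 + ENNReal.ofReal (ε * c / u)) := by ring
      _ ≤ expE (s * c + ε * c / u) := by
          rw [expE_add]
          gcongr
          exact one_add_ofReal_le_expE (by positivity)
  have hB1 : 1 ≤ expE (s * c + ε * c / u) := one_le_expE (by positivity)
  have hmid := measure_sum_gt_and_exists_gt_le hXmeas hXindep hXident hs0 u x k hJs hB hB1
  have hexp : (k : ENNReal) * (expE (-(s * x)) * (expE (s * u - g u) * K *
      expE (s * c + ε * c / u) ^ k)) ≤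
      K * (expE (-g x + ε * g x) * (k * expE (s * c * k))) := by
    have h1 : expE (-(s * x)) * expE (s * u - g u) * expE (s * c + ε * c / u) ^ k ≤
        expE (-g x + ε * g x) * expE (s * c * k) := by
      rw [← expE_nat_mul, ← expE_add, ← expE_add, ← expE_add]
      refine expE_le_expE ?_
      -- The window's contribution to the k-th power costs only ε g(x), because ck ≤ x and 1/u =
      -- g(x)/x.
      have h2 : (k : ℝ) * (ε * c / u) ≤ ε * g x := by
        calc (k : ℝ) * (ε * c / u) = ε * (g x * (c * k / x)) := by
              rw [hudef]; field_simp
          _ ≤ ε * (g x * 1) := by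
              gcongr
              exact (div_le_one hx).2 hck
          _ = ε * g x := by ring
      rw [hsx]
      linarith
    calc _ = k * K * (expE (-(s * x)) * expE (s * u - g u) *
          expE (s * c + ε * c / u) ^ k) := by ring
      _ ≤ k * K * (expE (-g x + ε * g x) * expE (s * c * k)) := by gcongr
      _ = _ := by ring
  -- If ck ≤ u, the exponential is at most e. Otherwise the chord inequality bounds it by
  -- e^{1+g(ck)-g(u)}, and k ≤ x/c is at most c⁻¹ e^{g(u)+εg(x)}, so g(u) cancels.
  have hkey : (k : ENNReal) * expE (s * c * k) ≤
      expE 1 * (1 + ENNReal.ofReal c⁻¹) * expE (ε * g x) * (k + expE (g (c * k))) := by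
    have h1e : 1 ≤ expE (ε * g x) := one_le_expE (by positivity)
    by_cases hku : c * k ≤ u
    · calc (k : ENNReal) * expE (s * c * k) ≤ k * expE 1 := by
            gcongr
            refine expE_le_expE (le_trans ?_ hsu)
            rw [mul_assoc]
            gcongr
        _ = expE 1 * 1 * 1 * (k + 0) := by ring
        _ ≤ _ := by
            gcongr
            · exact le_self_add
            · exact zero_le
    · have h2 := hg.slope_mul_le hu0.le (not_le.1 hku).le hck hux
      have h3 : (k : ENNReal) ≤ ENNReal.ofReal c⁻¹ * expE (g u + ε * g x) := by
        calc (k : ENNReal) = ENNReal.ofReal k := (ENNReal.ofReal_natCast k).symm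
          _ ≤ ENNReal.ofReal (c⁻¹ * x) := by
              refine ENNReal.ofReal_le_ofReal ?_
              rw [inv_mul_eq_div, le_div_iff₀ hc0]
              linarith
          _ = ENNReal.ofReal c⁻¹ * expE (Real.log x) := by
              rw [ENNReal.ofReal_mul (by positivity), expE, Real.exp_log hx]
          _ ≤ _ := by
              gcongr
              exact expE_le_expE hlogx
      calc (k : ENNReal) * expE (s * c * k)
          ≤ ENNReal.ofReal c⁻¹ * expE (g u + ε * g x) * expE (1 + g (c * k) - g u) := by
            gcongr
            exact expE_le_expE (by linarith)
        _ = ENNReal.ofReal c⁻¹ * (expE (g u + ε * g x) * expE (1 + g (c * k) - g u)) := by ring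
        _ = ENNReal.ofReal c⁻¹ * (expE 1 * expE (ε * g x) * expE (g (c * k))) := by
            rw [← expE_add, ← expE_add, ← expE_add]
            ring_nf
        _ = expE 1 * (0 + ENNReal.ofReal c⁻¹) * expE (ε * g x) * (0 + expE (g (c * k))) := by ring
        _ ≤ _ := by
            gcongr
            · exact zero_le
            · exact zero_le
  have hcover : {ω | x < ∑ i ∈ Finset.range k, X i ω} ⊆
      {ω | x < ∑ i ∈ Finset.range k, X i ω ∧ ∀ i ∈ Finset.range k, X i ω ∈ Set.Iic u} ∪
      {ω | ∃ i ∈ Finset.range k, x < X i ω} ∪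
      {ω | x < ∑ i ∈ Finset.range k, X i ω ∧ (∀ i ∈ Finset.range k, X i ω ≤ x) ∧
        ∃ i ∈ Finset.range k, u < X i ω} := by
    intro ω hω
    by_cases h1 : ∃ i ∈ Finset.range k, x < X i ω
    · exact Or.inl (Or.inr h1)
    by_cases h2 : ∃ i ∈ Finset.range k, u < X i ω
    · push Not at h1
      exact Or.inr ⟨hω, h1, h2⟩
    · push Not at h2
      exact Or.inl (Or.inl ⟨hω, h2⟩)
  have hle : expE (-g x) ≤ expE (-g x + 2 * ε * g x) := expE_le_expE (by nlinarith)
  have e2 : expE (-g x + ε * g x) * expE (ε * g x) = expE (-g x + 2 * ε * g x) := by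
    rw [← expE_add]; ring_nf
  calc μ {ω | x < ∑ i ∈ Finset.range k, X i ω}
      ≤ expE (-g x) * expE (g (c * k)) + k * (expE (-g x) * K) +
        K * (expE (-g x + ε * g x) * (k * expE (s * c * k))) :=
        (measure_mono hcover).trans ((measure_union_le _ _).trans
          (add_le_add ((measure_union_le _ _).trans (add_le_add hsmall hbig)) (hmid.trans hexp)))
    _ ≤ expE (-g x + 2 * ε * g x) * (k + expE (g (c * k))) +
        (k + expE (g (c * k))) * (expE (-g x + 2 * ε * g x) * K) +
        K * (expE (-g x + ε * g x) * (expE 1 * (1 + ENNReal.ofReal c⁻¹) * expE (ε * g x) *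
          (k + expE (g (c * k))))) := by
        gcongr
        · exact le_add_self
        · exact le_self_add
    _ = expE (-g x + 2 * ε * g x) * (k + expE (g (c * k))) +
        (k + expE (g (c * k))) * (expE (-g x + 2 * ε * g x) * K) +
        K * ((expE (-g x + ε * g x) * expE (ε * g x)) * (expE 1 * (1 + ENNReal.ofReal c⁻¹) *
          (k + expE (g (c * k))))) := by ring
    _ = _ := by rw [e2]; ring

/-- Tail bound for the randomly stopped sum when both the terms and the number of terms have
exponential moments along the scale function. -/
theorem IsScale.eventually_measure_stoppedSum_le [IsProbabilityMeasure μ] (hg : IsScale g)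
    (hg0 : Tendsto (fun x => g x / x) atTop (𝓝 0)) {δ : ℝ} (hδ : 0 < δ)
    (hlog : ∀ᶠ x in atTop, (1 + δ) * Real.log x ≤ g x)
    (hXmeas : ∀ i, Measurable (X i)) (hXindep : iIndepFun X μ)
    (hXident : ∀ i, IdentDistrib (X i) (X 0) μ μ) (hXint : Integrable (X 0) μ)
    (hXnonneg : ∀ᵐ ω ∂μ, 0 ≤ X 0 ω)
    {N : Ω → ℕ} (hNmeas : Measurable N) (hNindep : IndepFun N (fun ω i => X i ω) μ)
    (hK : ∫⁻ ω, expE (g (max 0 (X 0 ω))) ∂μ < ⊤) {c : ℝ} (hc : ∫ ω, X 0 ω ∂μ < c)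
    (hKN : ∫⁻ ω, expE (g (c * N ω)) ∂μ < ⊤) {ε : ℝ} (hε : 0 < ε) :
    ∀ᶠ x in atTop, μ {ω | x < stoppedSum X N ω} ≤ expE (-((1 - ε) * g x)) := by
  have hc0 : 0 < c := (integral_nonneg_of_ae hXnonneg).trans_lt hc
  -- Two thirds of ε are spent in the uniform bound; the last third absorbs the constant `D`.
  obtain ⟨C, hC, hbound⟩ := hg.exists_measure_sum_gt_le hg0 hδ hlog hXmeas hXindep hXident hXint
    hXnonneg hK hc (ε := ε / 3) (by positivity)
  have hNm : Measurable fun ω => (N ω : ENNReal) := measurable_from_top.comp hNmeas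
  have hgm : Measurable fun ω => expE (g (c * N ω)) :=
    (measurable_from_top (f := fun k : ℕ => expE (g (c * k)))).comp hNmeas
  have hEN : ∫⁻ ω, (N ω : ENNReal) ∂μ < ⊤ := by
    obtain ⟨a, ha⟩ := eventually_atTop.1 hlog
    have hpt : ∀ ω, (N ω : ENNReal) ≤
        ENNReal.ofReal c⁻¹ * (ENNReal.ofReal (max a 1) + expE (g (c * N ω))) := by
      intro ω
      have e : (N ω : ENNReal) = ENNReal.ofReal c⁻¹ * ENNReal.ofReal (c * N ω) := by
        rw [← ENNReal.ofReal_mul (by positivity), ← ENNReal.ofReal_natCast]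
        congr 1
        field_simp
      rw [e]
      gcongr
      by_cases h : c * N ω ≤ max a 1
      · exact (ENNReal.ofReal_le_ofReal h).trans le_self_add
      · have h' := (not_le.1 h).le
        have h1 : 1 ≤ c * N ω := (le_max_right _ _).trans h'
        refine le_trans ?_ le_add_self
        refine ENNReal.ofReal_le_ofReal ?_
        rw [← Real.log_le_iff_le_exp (by linarith)]
        have h2 := ha _ ((le_max_left _ _).trans h')
        have h3 := mul_nonneg hδ.le (Real.log_nonneg h1)
        linarith
    refine (lintegral_mono hpt).trans_lt ?_
    rw [lintegral_const_mul _ (hgm.const_add _), lintegral_add_left measurable_const]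
    exact ENNReal.mul_lt_top ENNReal.ofReal_lt_top (ENNReal.add_lt_top.2
      ⟨by simp, hKN⟩)
  set D := C * (∫⁻ ω, (N ω : ENNReal) ∂μ + ∫⁻ ω, expE (g (c * N ω)) ∂μ) with hD
  have hDtop : D ≠ ⊤ := ENNReal.mul_ne_top hC (ENNReal.add_lt_top.2 ⟨hEN, hKN⟩).ne
  have hsmall : ∀ᶠ x in atTop, D.toReal ≤ ε / 3 * g x :=
    (hg.tendsto_atTop.const_mul_atTop (show 0 < ε / 3 by positivity)).eventually_ge_atTop _
  filter_upwards [hbound, hsmall] with x hx hDx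
  rw [measure_lt_stoppedSum hXmeas hNmeas hNindep]
  calc _ ≤ ∫⁻ ω, C * expE (-g x + 2 * (ε / 3) * g x) * (N ω + expE (g (c * N ω))) ∂μ :=
        lintegral_mono fun ω => hx (N ω)
    _ = expE (-g x + 2 * (ε / 3) * g x) * D := by
        have hm : Measurable fun ω => (N ω : ENNReal) + expE (g (c * N ω)) := hNm.add hgm
        rw [lintegral_const_mul _ hm, lintegral_add_left hNm, hD]
        ring
    _ ≤ expE (-g x + 2 * (ε / 3) * g x) * expE (ε / 3 * g x) := by
        gcongr
        rw [← ENNReal.ofReal_toReal hDtop]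
        exact (ofReal_le_expE _).trans (expE_le_expE hDx)
    _ = expE (-((1 - ε) * g x)) := by rw [← expE_add]; ring_nf

end Main

/-! ### Upper and lower tail asymptotics of the stopped sum -/

section Asymptotics

variable {Ω : Type*} [MeasurableSpace Ω] {μ : Measure Ω} {X : ℕ → Ω → ℝ} {N : Ω → ℕ} {h : ℝ → ℝ}

/-- The upper tail bound for the stopped sum, from tail bounds of the terms and of multiples of the
number of terms with factor above the mean. -/
theorem IsScale.eventually_measure_stoppedSum_le_of_tails [IsProbabilityMeasure μ] (hh : IsScale h)
    (hh0 : Tendsto (fun x => h x / x) atTop (𝓝 0)) {δ : ℝ} (hδ : 0 < δ)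
    (hlog : ∀ᶠ x in atTop, (1 + δ) * Real.log x ≤ h x)
    (hXmeas : ∀ i, Measurable (X i)) (hXindep : iIndepFun X μ)
    (hXident : ∀ i, IdentDistrib (X i) (X 0) μ μ) (hXint : Integrable (X 0) μ)
    (hXnonneg : ∀ᵐ ω ∂μ, 0 ≤ X 0 ω)
    (hNmeas : Measurable N) (hNindep : IndepFun N (fun ω i => X i ω) μ)
    (hXtail : ∀ ρ : ℝ, 0 < ρ → ρ < 1 → ∀ᶠ x in atTop, μ {ω | x < X 0 ω} ≤ expE (-(ρ * h x)))
    (hNtail : ∀ ρ : ℝ, 0 < ρ → ρ < 1 → ∃ c : ℝ, ∫ ω, X 0 ω ∂μ < c ∧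
      ∀ᶠ x in atTop, μ {ω | x < c * N ω} ≤ expE (-(ρ * h x)))
    {ρ : ℝ} (hρ0 : 0 < ρ) (hρ1 : ρ < 1) :
    ∀ᶠ x in atTop, μ {ω | x < stoppedSum X N ω} ≤ expE (-(ρ * h x)) := by
  -- The scale ah must still beat the logarithm by a factor above 1, hence a > 1/(1+δ); the gap a <
  -- b yields finite moments, and a > ρ leaves room for the loss ε.
  obtain ⟨a, ha, ha1⟩ : ∃ a, max ρ (1 / (1 + δ)) < a ∧ a < 1 :=
    exists_between (max_lt hρ1 ((div_lt_one (by linarith)).2 (by linarith)))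
  obtain ⟨b, hab, hb1⟩ := exists_between ha1
  have hρa : ρ < a := (le_max_left _ _).trans_lt ha
  have ha0 : 0 < a := hρ0.trans hρa
  have hδa : 1 < a * (1 + δ) := by
    have := (le_max_right _ _).trans_lt ha
    rwa [div_lt_iff₀ (by linarith)] at this
  have hb0 : 0 < b := ha0.trans hab
  obtain ⟨c, hc, hct⟩ := hNtail b hb0 hb1
  have hc0 : 0 < c := (integral_nonneg_of_ae hXnonneg).trans_lt hc
  have hK := hh.lintegral_expE_lt_top (hXmeas 0) ha0 hab (hXtail b hb0 hb1)
  have hNm : Measurable fun ω => c * (N ω : ℝ) :=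
    (measurable_from_top (f := fun k : ℕ => c * (k : ℝ))).comp hNmeas
  have hKN := hh.lintegral_expE_lt_top hNm ha0 hab hct
  have hKN' : ∫⁻ ω, expE (a * h (c * N ω)) ∂μ < ⊤ := by
    convert hKN using 4 with ω
    rw [max_eq_right]
    positivity
  have hlog' : ∀ᶠ x in atTop, (1 + (a * (1 + δ) - 1)) * Real.log x ≤ a * h x := by
    filter_upwards [hlog] with x hx
    have := mul_le_mul_of_nonneg_left hx ha0.le
    linarith
  have hh0' : Tendsto (fun x => a * h x / x) atTop (𝓝 0) := by
    simpa [mul_div_assoc] using hh0.const_mul a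
  have := (hh.const_mul ha0).eventually_measure_stoppedSum_le hh0' (sub_pos.2 hδa) hlog' hXmeas
    hXindep hXident hXint hXnonneg hNmeas hNindep hK hc hKN' (ε := 1 - ρ / a)
    (sub_pos.2 ((div_lt_one ha0).2 hρa))
  filter_upwards [this] with x hx
  convert hx using 3
  field_simp
  ring

/-- A tail bound along `k` gives one along any scale asymptotically not larger than `k`. -/
theorem eventually_measure_le_of_one_le_liminf {Y : Ω → ℝ} {k : ℝ → ℝ}
    (hh : Tendsto h atTop atTop)
    (hY : ∀ ρ : ℝ, ρ < 1 → ∀ᶠ x in atTop, μ {ω | x < Y ω} ≤ expE (-(ρ * k x)))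
    (hl : 1 ≤ liminf (fun x : ℝ => ((k x / h x : ℝ) : EReal)) atTop)
    {ρ : ℝ} (hρ0 : 0 < ρ) (hρ1 : ρ < 1) :
    ∀ᶠ x in atTop, μ {ω | x < Y ω} ≤ expE (-(ρ * h x)) := by
  -- This factor is lost twice, in the tail and in comparing scales; its square is at least ρ.
  have hσ1 : (1 + ρ) / 2 < 1 := by linarith
  have h1 : (((1 + ρ) / 2 : ℝ) : EReal) <
      liminf (fun x : ℝ => ((k x / h x : ℝ) : EReal)) atTop :=
    lt_of_lt_of_le (by exact_mod_cast hσ1) hl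
  filter_upwards [eventually_lt_of_lt_liminf h1, hh.eventually_gt_atTop 0, hY _ hσ1]
    with x hx hx0 hxY
  refine hxY.trans (expE_le_expE (neg_le_neg ?_))
  have h2 : (1 + ρ) / 2 < k x / h x := by exact_mod_cast hx
  rw [lt_div_iff₀ hx0] at h2
  calc ρ * h x ≤ ((1 + ρ) / 2 * ((1 + ρ) / 2)) * h x := by
        gcongr
        nlinarith [sq_nonneg (1 - ρ)]
    _ = (1 + ρ) / 2 * ((1 + ρ) / 2 * h x) := by ring
    _ ≤ _ := by gcongr

/-- A weak law of large numbers as a lower bound for probabilities. -/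
theorem eventually_half_le_measure_sum_gt [IsProbabilityMeasure μ]
    (hXmeas : ∀ i, Measurable (X i)) (hXindep : iIndepFun X μ)
    (hXident : ∀ i, IdentDistrib (X i) (X 0) μ μ) (hXint : Integrable (X 0) μ)
    {a : ℝ} (ha : a < ∫ ω, X 0 ω ∂μ) :
    ∀ᶠ n : ℕ in atTop, 1 / 2 ≤ μ {ω | a * n < ∑ i ∈ Finset.range n, X i ω} := by
  have hlln := strong_law_ae_real X hXint (fun i j hij => hXindep.indepFun hij) hXident
  have hm : ∀ n : ℕ, Measurable fun ω => ∑ i ∈ Finset.range n, X i ω := fun n =>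
    Finset.measurable_fun_sum _ fun i _ => hXmeas i
  have hin := tendstoInMeasure_iff_dist.1 (tendstoInMeasure_of_tendsto_ae
    (fun n : ℕ => ((hm n).div_const (n : ℝ)).aestronglyMeasurable) hlln) _ (sub_pos.2 ha)
  have hhalf : (0 : ENNReal) < 1 / 2 := by simp
  filter_upwards [hin.eventually_lt_const hhalf, eventually_gt_atTop 0] with n hn hn0
  have hn0' : (0 : ℝ) < n := by exact_mod_cast hn0
  have hcompl : μ {ω | a * n < ∑ i ∈ Finset.range n, X i ω}ᶜ ≤ 1 / 2 := by
    refine (measure_mono fun ω hω => ?_).trans hn.le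
    have h1 : (∑ i ∈ Finset.range n, X i ω) / n ≤ a := (div_le_iff₀ hn0').2 (not_lt.1 hω)
    rw [Set.mem_ofPred_eq, Real.dist_eq, abs_sub_comm]
    exact (sub_le_sub_left h1 _).trans (le_abs_self _)
  have hsum := prob_add_prob_compl (μ := μ) (measurableSet_lt measurable_const (hm n) :
    MeasurableSet {ω | a * n < ∑ i ∈ Finset.range n, X i ω})
  by_contra hlt
  have := ENNReal.add_lt_add_of_lt_of_le (by finiteness) (not_le.1 hlt) hcompl
  rw [hsum, ENNReal.add_halves] at this
  exact lt_irrefl _ this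

/-- The number of terms forces the stopped sum of a sequence with positive mean to be large. -/
theorem eventually_half_mul_le_measure_stoppedSum [IsProbabilityMeasure μ]
    (hXmeas : ∀ i, Measurable (X i)) (hXindep : iIndepFun X μ)
    (hXident : ∀ i, IdentDistrib (X i) (X 0) μ μ) (hXint : Integrable (X 0) μ)
    (hNmeas : Measurable N) (hNindep : IndepFun N (fun ω i => X i ω) μ)
    {a : ℝ} (ha0 : 0 < a) (ha : a < ∫ ω, X 0 ω ∂μ) :
    ∀ᶠ x in atTop, 1 / 2 * μ {ω | x < a * N ω} ≤ μ {ω | x < stoppedSum X N ω} := by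
  obtain ⟨n₀, hn₀⟩ := eventually_atTop.1
    (eventually_half_le_measure_sum_gt hXmeas hXindep hXident hXint ha)
  filter_upwards [eventually_ge_atTop (a * n₀)] with x hx
  have hS : MeasurableSet {ω | x < a * N ω} := measurableSet_lt measurable_const
    ((measurable_from_top (f := fun k : ℕ => a * (k : ℝ))).comp hNmeas)
  rw [measure_lt_stoppedSum hXmeas hNmeas hNindep, ← lintegral_indicator_const hS]
  refine lintegral_mono fun ω => ?_
  refine Set.indicator_apply_le' (fun hω => ?_) fun _ => zero_le
  have hlt : a * n₀ < a * N ω := hx.trans_lt hω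
  have hn : n₀ ≤ N ω := by exact_mod_cast (lt_of_mul_lt_mul_left hlt ha0.le).le
  exact (hn₀ _ hn).trans (measure_mono fun ω' (hω' : _ < _) =>
    show x < _ from lt_trans hω hω')

/-- The lower tail bound for the stopped sum, from the lower tail bound of the number of terms
multiplied by the mean. -/
theorem IsScale.eventually_le_measure_stoppedSum [IsProbabilityMeasure μ] (hh : IsScale h)
    (hXmeas : ∀ i, Measurable (X i)) (hXindep : iIndepFun X μ)
    (hXident : ∀ i, IdentDistrib (X i) (X 0) μ μ) (hXint : Integrable (X 0) μ)
    (hXmean : 0 < ∫ ω, X 0 ω ∂μ)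
    (hNmeas : Measurable N) (hNindep : IndepFun N (fun ω i => X i ω) μ)
    (htail : ∀ ρ : ℝ, 1 < ρ → ∀ᶠ x in atTop,
      expE (-(ρ * h x)) ≤ μ {ω | x < (∫ ω', X 0 ω' ∂μ) * N ω}) {ρ : ℝ} (hρ : 1 < ρ) :
    ∀ᶠ x in atTop, expE (-(ρ * h x)) ≤ μ {ω | x < stoppedSum X N ω} := by
  obtain ⟨σ, hσ1, hσρ⟩ := exists_between hρ
  have hρ0 : 0 < ρ := by linarith
  -- Concavity gives h(x/θ) ≤ h(x)/θ; σ/θ < ρ leaves a positive multiple of h(x) to absorb the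
  -- factor 1/2 of the weak law.
  obtain ⟨θ, hσθ, hθ1⟩ := exists_between ((div_lt_one hρ0).2 hσρ)
  have hθ0 : 0 < θ := lt_trans (div_pos (by linarith) hρ0) hσθ
  have hgap : 0 < ρ - σ / θ := by
    rw [div_lt_iff₀ hρ0] at hσθ
    rw [sub_pos, div_lt_iff₀ hθ0]
    linarith
  have hscale : Tendsto (fun x : ℝ => x / θ) atTop atTop := tendsto_id.atTop_div_const hθ0
  filter_upwards [eventually_half_mul_le_measure_stoppedSum hXmeas hXindep hXident hXint hNmeas
      hNindep (mul_pos hθ0 hXmean) (mul_lt_of_lt_one_left hXmean hθ1),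
    hscale.eventually (htail σ hσ1),
    (hh.tendsto_atTop.const_mul_atTop hgap).eventually_ge_atTop 1,
    eventually_ge_atTop 0] with x hx1 hx2 hx3 hx4
  have hset : {ω | x / θ < (∫ ω', X 0 ω' ∂μ) * N ω} = {ω | x < θ * (∫ ω', X 0 ω' ∂μ) * N ω} := by
    ext ω
    rw [Set.mem_ofPred_eq, Set.mem_ofPred_eq, div_lt_iff₀ hθ0]
    ring_nf
  rw [hset] at hx2
  refine le_trans ?_ hx1
  have hhalf : expE (-1) ≤ 1 / 2 := by
    have h1 : (1 / 2 : ENNReal) = ENNReal.ofReal (1 / 2) := by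
      rw [ENNReal.ofReal_div_of_pos two_pos]; simp
    rw [h1, expE]
    refine ENNReal.ofReal_le_ofReal ?_
    rw [Real.exp_neg, one_div]
    exact inv_anti₀ two_pos (by linarith [Real.add_one_le_exp 1])
  calc expE (-(ρ * h x)) ≤ expE (-1 + -(σ * h (x / θ))) := by
        refine expE_le_expE ?_
        have h1 := hh.mul_le hθ0.le hθ1.le (div_nonneg hx4 hθ0.le)
        rw [mul_div_cancel₀ _ hθ0.ne'] at h1
        have h2 : h (x / θ) ≤ h x / θ := by
          rw [le_div_iff₀ hθ0]; linarith
        have h3 : σ * h (x / θ) ≤ σ * (h x / θ) := by gcongr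
        have h4 : σ * (h x / θ) = σ / θ * h x := by ring
        linarith
    _ = expE (-1) * expE (-(σ * h (x / θ))) := expE_add _ _
    _ ≤ _ := mul_le_mul' hhalf hx2

end Asymptotics

/-! ### The single-term lower bound and the theorem -/

/-- A nonnegative sum with at least one term is at least its first term. -/
theorem measure_gt_le_measure_stoppedSum {Ω : Type*} [MeasurableSpace Ω] {μ : Measure Ω}
    {X : ℕ → Ω → ℝ} {N : Ω → ℕ} (hXident : ∀ i, IdentDistrib (X i) (X 0) μ μ)
    (hNpos : ∀ᵐ ω ∂μ, 1 ≤ N ω) (hXnonneg : ∀ᵐ ω ∂μ, 0 ≤ X 0 ω) (x : ℝ) :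
    μ {ω | x < X 0 ω} ≤ μ {ω | x < stoppedSum X N ω} := by
  have hall : ∀ᵐ ω ∂μ, ∀ i, 0 ≤ X i ω := ae_all_iff.2 fun i =>
    (hXident i).symm.ae_snd (measurableSet_Ici (a := (0 : ℝ))) hXnonneg
  refine measure_mono_ae ?_
  filter_upwards [hall, hNpos] with ω h1 h2 hω
  exact lt_of_lt_of_le hω (Finset.single_le_sum (f := fun i => X i ω) (fun i _ => h1 i)
    (Finset.mem_range.2 h2))

theorem corollary2 {Ω : Type*} [MeasurableSpace Ω] (μ : Measure Ω) [IsProbabilityMeasure μ]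
    (X : ℕ → Ω → ℝ) (N : Ω → ℕ)
    (hXmeas : ∀ i, Measurable (X i)) (hNmeas : Measurable N)
    (hXindep : iIndepFun X μ) (hXident : ∀ i, IdentDistrib (X i) (X 0) μ μ)
    (hNindep : IndepFun N (fun ω i => X i ω) μ)
    (hNpos : ∀ᵐ ω ∂μ, 1 ≤ N ω)
    (hXheavy : HeavyTailed μ (X 0)) (hNheavy : HeavyTailed μ (fun ω => (N ω : ℝ)))
    (hXint : Integrable (X 0) μ) (hXmean : 0 < ∫ ω, X 0 ω ∂μ)
    (hXnonneg : ∀ᵐ ω ∂μ, 0 ≤ X 0 ω) :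
    -- first part: the increment dominates
    (∀ (δ : ℝ) (hX : ℝ → ℝ), 0 < δ →
      ∫⁻ ω, ENNReal.ofReal (max 0 (X 0 ω) ^ (1 + δ)) ∂μ < ⊤ →
      IsNaturalScale μ (X 0) hX →
      (∀ᶠ x in atTop, (1 + δ) * Real.log x ≤ hX x) →
      Tendsto (fun x : ℝ => hazard μ (X 0) x / (hX x : EReal)) atTop (𝓝 1) →
      (∃ (hN : ℝ → ℝ) (c₁ : ℝ), IsNaturalScale μ (fun ω => (N ω : ℝ)) hN ∧
        (∫ ω, X 0 ω ∂μ) < c₁ ∧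
        1 ≤ liminf (fun x : ℝ => ((hN (x / c₁) / hX x : ℝ) : EReal)) atTop) →
      Tendsto (fun x : ℝ => hazard μ (stoppedSum X N) x / (hX x : EReal)) atTop (𝓝 1)) ∧
    -- second part: the stopping variable dominates; `x ↦ hN (x / E X)` is the scale of `E(X) N`
    (∀ (δ : ℝ) (hN : ℝ → ℝ), 0 < δ →
      ∫⁻ ω, ENNReal.ofReal ((N ω : ℝ) ^ (1 + δ)) ∂μ < ⊤ →
      IsNaturalScale μ (fun ω => (N ω : ℝ)) hN →
      (∀ᶠ x in atTop, (1 + δ) * Real.log x ≤ hN x) →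
      Tendsto (fun x : ℝ => hazard μ (fun ω => (∫ ω', X 0 ω' ∂μ) * (N ω : ℝ)) x /
        (hN (x / ∫ ω', X 0 ω' ∂μ) : EReal)) atTop (𝓝 1) →
      (∃ hX : ℝ → ℝ, IsNaturalScale μ (X 0) hX ∧
        1 ≤ liminf (fun x : ℝ => ((hX x / hN (x / ∫ ω', X 0 ω' ∂μ) : ℝ) : EReal)) atTop) →
      Tendsto (fun x : ℝ => hazard μ (stoppedSum X N) x /
        (hN (x / ∫ ω', X 0 ω' ∂μ) : EReal)) atTop (𝓝 1)) := by
  have htail : ∀ {Y : Ω → ℝ} {k : ℝ → ℝ} (_ : Tendsto k atTop atTop)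
      (_ : Tendsto (fun x : ℝ => hazard μ Y x / (k x : EReal)) atTop (𝓝 1)) (ρ : ℝ), ρ < 1 →
      ∀ᶠ x in atTop, μ {ω | x < Y ω} ≤ expE (-(ρ * k x)) := fun hk hl _ hρ =>
    eventually_measure_le_of_liminf hk hl.liminf_eq.ge hρ
  refine ⟨?_, ?_⟩
  · rintro δ hX hδ - hXs hlog hlim ⟨hN, c, hNs, hc, hdom⟩
    have hsc := hXs.isScale
    have hc0 : 0 < c := hXmean.trans hc
    have hXtail := htail hsc.tendsto_atTop hlim
    have hNtail : ∀ ρ : ℝ, ρ < 1 →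
        ∀ᶠ x in atTop, μ {ω | x < c * (N ω : ℝ)} ≤ expE (-(ρ * hN (x / c))) := by
      intro ρ hρ
      have h1 := eventually_measure_le_of_liminf hNs.tendsto_atTop hNs.liminf_eq_one.ge hρ
      have h2 : Tendsto (fun x : ℝ => x / c) atTop atTop := tendsto_id.atTop_div_const hc0
      filter_upwards [h2.eventually h1] with x hx
      simpa only [div_lt_iff₀' hc0] using hx
    refine tendsto_hazard_div hsc.tendsto_atTop (fun ρ hρ0 hρ1 => ?_) (fun ρ hρ => ?_)
    · exact hsc.eventually_measure_stoppedSum_le_of_tails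
        (hXheavy.tendsto_div (hXmeas 0) hsc one_half_pos (hXtail _ one_half_lt_one)) hδ hlog
        hXmeas hXindep hXident hXint hXnonneg hNmeas hNindep (fun ρ _ hρ1 => hXtail ρ hρ1)
        (fun ρ hρ0 hρ1 => ⟨c, hc, eventually_measure_le_of_one_le_liminf
          (k := fun x => hN (x / c)) hsc.tendsto_atTop hNtail hdom hρ0 hρ1⟩) hρ0 hρ1
    · filter_upwards [eventually_le_measure_of_tendsto hsc.tendsto_atTop hlim hρ] with x hx
      exact hx.trans (measure_gt_le_measure_stoppedSum hXident hNpos hXnonneg x)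
  · rintro δ hN hδ - hNs hlog hlim ⟨hX, hXs, hdom⟩
    set m := ∫ ω, X 0 ω ∂μ with hm
    set h : ℝ → ℝ := fun x => hN (x / m) with hh
    have hsc : IsScale h := hNs.isScale.comp_div hXmean
    have hNtail := htail hsc.tendsto_atTop hlim
    have hmNmeas : Measurable fun ω => m * (N ω : ℝ) :=
      (measurable_from_top (f := fun k : ℕ => m * (k : ℝ))).comp hNmeas
    have hmNheavy : HeavyTailed μ fun ω => m * (N ω : ℝ) := by
      intro s hs
      simpa only [mul_assoc] using hNheavy (s * m) (mul_pos hs hXmean)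
    -- Rescaling by m shifts the logarithm by a constant, absorbed by halving δ.
    have hlog' : ∀ᶠ x in atTop, (1 + δ / 2) * Real.log x ≤ h x := by
      have h1 : Tendsto (fun x : ℝ => x / m) atTop atTop := tendsto_id.atTop_div_const hXmean
      have h2 : Tendsto (fun x : ℝ => δ / 2 * Real.log x) atTop atTop :=
        Real.tendsto_log_atTop.const_mul_atTop (half_pos hδ)
      filter_upwards [h1.eventually hlog, h2.eventually_ge_atTop ((1 + δ) * Real.log m),
        eventually_gt_atTop 0] with x hx1 hx2 hx3
      rw [Real.log_div hx3.ne' hXmean.ne'] at hx1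
      linarith
    refine tendsto_hazard_div hsc.tendsto_atTop (fun ρ hρ0 hρ1 => ?_) (fun ρ hρ => ?_)
    · refine hsc.eventually_measure_stoppedSum_le_of_tails
        (hmNheavy.tendsto_div hmNmeas hsc one_half_pos (hNtail _ one_half_lt_one)) (half_pos hδ)
        hlog' hXmeas hXindep hXident hXint hXnonneg hNmeas hNindep
        (fun ρ hρ0 hρ1 => eventually_measure_le_of_one_le_liminf hsc.tendsto_atTop
          (fun ρ hρ => eventually_measure_le_of_liminf hXs.tendsto_atTop
            hXs.liminf_eq_one.ge hρ) hdom hρ0 hρ1) (fun ρ hρ0 hρ1 => ?_) hρ0 hρ1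
      -- Only the tail of mN is given, whereas a factor above m is needed. Taking c = m/θ costs one
      -- θ through h(θx) ≥ θh(x) and the tail exponent another, and θ² ≥ ρ.
      set θ := (1 + ρ) / 2 with hθ
      have hθ0 : 0 < θ := by positivity
      have hθ1 : θ < 1 := by linarith
      refine ⟨m / θ, (lt_div_iff₀ hθ0).2 (mul_lt_of_lt_one_right hXmean hθ1), ?_⟩
      have h1 : Tendsto (fun x : ℝ => θ * x) atTop atTop := tendsto_id.const_mul_atTop hθ0
      filter_upwards [h1.eventually (hNtail θ hθ1), eventually_ge_atTop 0] with x hx hx0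
      have hset : {ω | x < m / θ * (N ω : ℝ)} = {ω | θ * x < m * (N ω : ℝ)} := by
        ext ω
        rw [Set.mem_ofPred_eq, Set.mem_ofPred_eq, div_mul_eq_mul_div, lt_div_iff₀' hθ0]
      rw [hset]
      refine hx.trans (expE_le_expE (neg_le_neg ?_))
      have h2 := hsc.mul_le hθ0.le hθ1.le hx0
      calc ρ * h x ≤ θ * θ * h x := by
            refine mul_le_mul_of_nonneg_right ?_ (hsc.nonneg x hx0)
            rw [hθ]
            nlinarith [sq_nonneg (1 - ρ)]
        _ = θ * (θ * h x) := by ring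
        _ ≤ θ * h (θ * x) := by gcongr
    · exact hsc.eventually_le_measure_stoppedSum hXmeas hXindep hXident hXint hXmean hNmeas
        hNindep (fun ρ hρ => eventually_le_measure_of_tendsto hsc.tendsto_atTop hlim hρ) hρ
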